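/- Let $\theta(z;p)=\prod_{j\ge0}(1-zp^j)(1-p^{j+1}/z)$ for real $z\ne0$ and $0<p<1$. For a non-negative integer $k$ put $(c;q,p)_k=\prod_{i=0}^{k-1}\theta(cq^i;p)$ and $(c_1,\dots,c_m;q,p)_k=(c_1;q,p)_k\cdots(c_m;q,p)_k$. For real $a,b,q,p,x$ and a non-negative integer $k$ define the elliptic binomial coefficient $$\begin{bmatrix}x\\k\end{bmatrix}_{a,b;q,p}=\frac{(q^{1+x-k},\,aq^{1+x-k},\,bq^{1+k},\,aq^{1-k}/b;\,q,p)_k}{(q,\,aq,\,bq^{1+x},\,aq^{1+x-2k}/b;\,q,p)_k},$$ where a quotient with vanishing denominator is read as $0$. Theorem. Let $q,p,a,b,x,y$ be real numbers and $k$ a non-negative integer such that $0<q<1$, $0<p<q^2$, $pq^{-x-1}<a\le bq^k<1$, $x\ge y\ge1$, and $x-y$ is a non-negative integer. Assume further that $y\ge k$ or that $y$ is an integer. Then $$\begin{bmatrix}x\\k\end{bmatrix}_{a,b;q,p}\begin{bmatrix}y\\k\end{bmatrix}_{a,b;q,p}\ \ge\ \begin{bmatrix}x+1\\k\end{bmatrix}_{a,b;q,p}\begin{bmatrix}y-1\\k\end{bmatrix}_{a,b;q,p}.$$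 -/

import Mathlib

noncomputable section

namespace EllBinom

/-- The infinite shifted factorial `(a; q)_∞ = ∏_{j ≥ 0} (1 - a q^j)`. -/
def qPochInf (a q : ℝ) : ℝ := ∏' j : ℕ, (1 - a * q ^ j)

/-- The modified Jacobi theta function `θ(x; p) = (x; p)_∞ (p/x; p)_∞`. -/
def theta (x p : ℝ) : ℝ := qPochInf x p * qPochInf (p / x) p

/-- The theta shifted factorial `(a; q, p)_k = θ(a; p) θ(a q; p) ⋯ θ(a q^(k-1); p)`. -/
def thetaFact (a q p : ℝ) (k : ℕ) : ℝ := ∏ i ∈ Finset.range k, theta (a * q ^ i) p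

/-- The elliptic binomial coefficient with real upper parameter `x` and lower parameter `k`,
`(q^(1+x-k), a q^(1+x-k), b q^(1+k), a q^(1-k)/b; q, p)_k /
  (q, a q, b q^(1+x), a q^(1+x-2k)/b; q, p)_k`. All the powers of `q` are real powers. -/
def ellBinom (a b q p x : ℝ) (k : ℕ) : ℝ :=
  (thetaFact (q ^ (1 + x - (k : ℝ))) q p k * thetaFact (a * q ^ (1 + x - (k : ℝ))) q p k *
      thetaFact (b * q ^ (1 + (k : ℝ))) q p k * thetaFact (a * q ^ (1 - (k : ℝ)) / b) q p k) /
    (thetaFact q q p k * thetaFact (a * q) q p k *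
      thetaFact (b * q ^ (1 + x)) q p k * thetaFact (a * q ^ (1 + x - 2 * (k : ℝ)) / b) q p k)

end EllBinom

end

/-!
Write `s = q ^ k`, `c = b * q ^ k`, `u = q ^ (x + 1)` and `θ z` for `theta z p`. Telescoping the
theta shifted factorials (`thetaFact_mul_theta`) gives `[x + 1] = [x] * W u`, where
`W u = θ u * θ (a u) * θ (c u / s) * θ (a u / (c s)) /
  (θ (u / s) * θ (a u / s) * θ (c u) * θ (a u / c))`,
so that for `k < y` the claim amounts to `W u ≤ W v` for `u = q ^ (x + 1) ≤ v = q ^ y`.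

This monotonicity already holds for each factor of the infinite products defining `θ`. For the
factors `1 - z * p ^ j` it is the rational inequality `one_sub_prod_le`: with `1 - z` in place of
`θ z`, numerator minus denominator of `W u` is a nonnegative constant times `u * (1 - a * u ^ 2 / s)`,
and the quotient of this by the denominator increases with `u`. The factors `1 - p ^ (j + 1) / z`
reduce to the same inequality, because the inversion `u ↦ p ^ (j + 1) * s / (a * u)` exchanges
numerator and denominator of `W` (`one_sub_inv_prod_le`). Multiplying over `j` and passing to the
limit gives `theta_prod_le`; the hypotheses keep all arguments in `(p, 1)`, where `θ` is positive.

If `y ≤ k` and `y` is an integer, `θ 1 = 0` makes the coefficient `[y - 1]` vanish, and either the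
right-hand side is nonnegative (`y = k`) or `[y]` vanishes as well (`y < k`).
-/

open Filter Topology

namespace EllBinom

/-! ### The theta function on `(p, 1)` -/

lemma summable_neg_mul_pow {p : ℝ} (hp0 : 0 < p) (hp1 : p < 1) (z : ℝ) :
    Summable fun j : ℕ => -(z * p ^ j) :=
  ((summable_geometric_of_lt_one hp0.le hp1).mul_left z).neg

lemma multipliable_one_sub_mul_pow {p : ℝ} (hp0 : 0 < p) (hp1 : p < 1) (z : ℝ) :
    Multipliable fun j : ℕ => 1 - z * p ^ j := by
  simpa only [sub_eq_add_neg] using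
    Real.multipliable_one_add_of_summable (summable_neg_mul_pow hp0 hp1 z)

lemma tendsto_qPochInf {p : ℝ} (hp0 : 0 < p) (hp1 : p < 1) (z : ℝ) :
    Tendsto (fun n : ℕ => ∏ j ∈ Finset.range n, (1 - z * p ^ j)) atTop (𝓝 (qPochInf z p)) :=
  (multipliable_one_sub_mul_pow hp0 hp1 z).hasProd.tendsto_prod_nat

lemma tendsto_theta {p : ℝ} (hp0 : 0 < p) (hp1 : p < 1) (z : ℝ) :
    Tendsto (fun n : ℕ => ∏ j ∈ Finset.range n, ((1 - z * p ^ j) * (1 - p / z * p ^ j))) atTop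
      (𝓝 (theta z p)) := by
  simpa only [Finset.prod_mul_distrib, theta] using
    (tendsto_qPochInf hp0 hp1 z).mul (tendsto_qPochInf hp0 hp1 (p / z))

lemma qPochInf_pos {p z : ℝ} (hp0 : 0 < p) (hp1 : p < 1) (hz0 : 0 < z) (hz1 : z < 1) :
    0 < qPochInf z p := by
  have hpos : ∀ j : ℕ, 0 < 1 - z * p ^ j := fun j => by
    have := mul_le_of_le_one_right hz0.le (pow_le_one₀ (n := j) hp0.le hp1.le)
    linarith
  have hsum : Summable fun j : ℕ => Real.log (1 - z * p ^ j) := by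
    simpa only [sub_eq_add_neg] using
      Real.summable_log_one_add_of_summable (summable_neg_mul_pow hp0 hp1 z)
  rw [qPochInf, ← Real.rexp_tsum_eq_tprod hpos hsum]
  exact Real.exp_pos _

lemma theta_pos {p z : ℝ} (hp0 : 0 < p) (hpz : p < z) (hz1 : z < 1) : 0 < theta z p := by
  have hz0 := hp0.trans hpz
  have hp1 := hpz.trans hz1
  exact mul_pos (qPochInf_pos hp0 hp1 hz0 hz1)
    (qPochInf_pos hp0 hp1 (div_pos hp0 hz0) ((div_lt_one hz0).2 hpz))

lemma theta_one (p : ℝ) : theta 1 p = 0 := by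
  have h : qPochInf 1 p = 0 := tprod_of_exists_eq_zero ⟨0, by simp⟩
  rw [theta, h, zero_mul]

/-! ### Theta shifted factorials -/

lemma thetaFact_mul_theta (z q p : ℝ) (k : ℕ) :
    thetaFact (z * q) q p k * theta z p = thetaFact z q p k * theta (z * q ^ k) p := by
  have h : ∀ i : ℕ, z * q * q ^ i = z * q ^ (i + 1) := fun i => by ring
  simp only [thetaFact, h]
  rw [← Finset.prod_range_succ (fun i => theta (z * q ^ i) p),
    Finset.prod_range_succ' (fun i => theta (z * q ^ i) p), pow_zero, mul_one]

/-- The bound `p * q < z * q ^ k` says that the last argument `z * q ^ (k - 1)` exceeds `p`, in a form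
that also makes sense for `k = 0`. -/
lemma thetaFact_pos {z q p : ℝ} {k : ℕ} (hp0 : 0 < p) (hq0 : 0 < q) (hq1 : q < 1) (hz0 : 0 < z)
    (hz1 : z < 1) (hz : p * q < z * q ^ k) : 0 < thetaFact z q p k := by
  refine Finset.prod_pos fun i hi => theta_pos hp0 ?_ ?_
  · have hik : q ^ k ≤ q ^ (i + 1) :=
      pow_le_pow_of_le_one hq0.le hq1.le (Finset.mem_range.1 hi)
    have h : p * q < z * q ^ i * q := by
      calc p * q < z * q ^ k := hz
        _ ≤ z * q ^ (i + 1) := by gcongr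
        _ = z * q ^ i * q := by ring
    exact lt_of_mul_lt_mul_right h hq0.le
  · exact (mul_le_of_le_one_right hz0.le (pow_le_one₀ hq0.le hq1.le)).trans_lt hz1

lemma thetaFact_eq_zero {z q : ℝ} (p : ℝ) {k i : ℕ} (hi : i < k) (h : z * q ^ i = 1) :
    thetaFact z q p k = 0 :=
  Finset.prod_eq_zero (Finset.mem_range.2 hi) (by rw [h, theta_one])

/-! ### Monotonicity of the quotient of consecutive coefficients -/

/-- The rational (`p = 0`) case of the monotonicity of the quotient of consecutive coefficients. -/
lemma one_sub_prod_le {a c s u v : ℝ} (ha : 0 < a) (hac : a ≤ c) (hc : c ≤ 1) (hs0 : 0 < s)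
    (hs1 : s ≤ 1) (hu : 0 < u) (huv : u ≤ v) (hvs : v ≤ s) :
    (1 - u) * (1 - a * u) * (1 - c * u / s) * (1 - a * u / (c * s)) *
        ((1 - v / s) * (1 - a * v / s) * (1 - c * v) * (1 - a * v / c)) ≤
      (1 - v) * (1 - a * v) * (1 - c * v / s) * (1 - a * v / (c * s)) *
        ((1 - u / s) * (1 - a * u / s) * (1 - c * u) * (1 - a * u / c)) := by
  have hc0 : 0 < c := ha.trans_le hac
  have ha1 : a ≤ 1 := hac.trans hc
  have hv : 0 < v := hu.trans_le huv
  set K : ℝ := (1 - c) * (1 - a / c) * ((1 - s) / s) with hK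
  have hK0 : 0 ≤ K := mul_nonneg
    (mul_nonneg (by linarith) (sub_nonneg.2 ((div_le_one hc0).2 hac)))
    (div_nonneg (by linarith) hs0.le)
  -- Numerator minus denominator factors, with a nonnegative constant `K`.
  have key : ∀ w : ℝ, (1 - w) * (1 - a * w) * (1 - c * w / s) * (1 - a * w / (c * s)) =
      (1 - w / s) * (1 - a * w / s) * (1 - c * w) * (1 - a * w / c) +
        K * (w * (1 - a * w ^ 2 / s)) := by
    intro w
    rw [hK]
    field_simp
    ring
  have hmain : (1 - a * u ^ 2 / s) * (1 - v / s) ≤ (1 - a * v ^ 2 / s) * (1 - u / s) := by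
    have h1 : (1 - a * v ^ 2 / s) * (1 - u / s) - (1 - a * u ^ 2 / s) * (1 - v / s) =
        (v - u) / s * ((1 - a) + a * ((1 - u) * (1 - v)) + a * (u * v) * ((1 - s) / s)) := by
      field_simp
      ring
    have h2 : 0 ≤ (1 - u) * (1 - v) := mul_nonneg (by linarith) (by linarith)
    have h3 : 0 ≤ (1 - s) / s := div_nonneg (by linarith) hs0.le
    have h4 : 0 ≤ (v - u) / s := div_nonneg (by linarith) hs0.le
    have h5 : 0 ≤ 1 - a := by linarith
    have : 0 ≤ (v - u) / s *
        ((1 - a) + a * ((1 - u) * (1 - v)) + a * (u * v) * ((1 - s) / s)) := by positivity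
    linarith
  have hvs1 : v / s ≤ 1 := (div_le_one hs0).2 hvs
  have hav : a * v ≤ v := mul_le_of_le_one_left hv.le ha1
  have e1 : 0 ≤ 1 - a * v / s := sub_nonneg.2 ((div_le_one hs0).2 (hav.trans hvs))
  have e2 : 0 ≤ 1 - c * v := by
    have := mul_le_of_le_one_left hv.le hc
    linarith
  have e3 : 0 ≤ 1 - a * v / c := by
    refine sub_nonneg.2 ((div_le_one hc0).2 ?_)
    exact (mul_le_of_le_one_right ha.le (hvs.trans hs1)).trans hac
  have e4 : 0 ≤ 1 - v / s := by linarith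
  have e5 : u / s ≤ 1 := (div_le_one hs0).2 (huv.trans hvs)
  have f1 : 1 - a * v / s ≤ 1 - a * u / s := by gcongr
  have f2 : 1 - c * v ≤ 1 - c * u := by gcongr
  have f3 : 1 - a * v / c ≤ 1 - a * u / c := by gcongr
  have e6 : 0 ≤ 1 - a * u ^ 2 / s := by
    refine sub_nonneg.2 ((div_le_one hs0).2 ?_)
    have h1 : a * u ^ 2 ≤ 1 * u ^ 2 := by gcongr
    have h2 : u ^ 2 ≤ u * 1 := by
      rw [sq]
      gcongr
      linarith
    linarith
  have e7 : 0 ≤ (1 - a * v ^ 2 / s) * (1 - u / s) := le_trans (mul_nonneg e6 e4) hmain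
  have hincr : u * ((1 - a * u ^ 2 / s) * (1 - v / s)) *
        ((1 - a * v / s) * (1 - c * v) * (1 - a * v / c)) ≤
      v * ((1 - a * v ^ 2 / s) * (1 - u / s)) *
        ((1 - a * u / s) * (1 - c * u) * (1 - a * u / c)) := by
    have g1 : 0 ≤ 1 - a * u / s := e1.trans f1
    have g2 : 0 ≤ 1 - c * u := e2.trans f2
    gcongr
  have := mul_le_mul_of_nonneg_left hincr hK0
  rw [key u, key v]
  linarith

/-- The counterpart of `one_sub_prod_le` for the factors `1 - P / z` of the theta function. -/
lemma one_sub_inv_prod_le {a c s u v P : ℝ} (ha : 0 < a) (hac : a ≤ c) (hc : c ≤ 1) (hs0 : 0 < s)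
    (hs1 : s ≤ 1) (hu : 0 < u) (huv : u ≤ v) (hP : 0 < P) (hPu : P ≤ a * u) :
    (1 - P / u) * (1 - P / (a * u)) * (1 - P / (c * u / s)) * (1 - P / (a * u / (c * s))) *
        ((1 - P / (v / s)) * (1 - P / (a * v / s)) * (1 - P / (c * v)) * (1 - P / (a * v / c))) ≤
      (1 - P / v) * (1 - P / (a * v)) * (1 - P / (c * v / s)) * (1 - P / (a * v / (c * s))) *
        ((1 - P / (u / s)) * (1 - P / (a * u / s)) * (1 - P / (c * u)) *
          (1 - P / (a * u / c))) := by
  have hc0 : 0 < c := ha.trans_le hac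
  have hv : 0 < v := hu.trans_le huv
  have h := one_sub_prod_le (u := P * s / (a * v)) (v := P * s / (a * u)) ha hac hc hs0 hs1
    (by positivity) (by gcongr)
    (by
      rw [div_le_iff₀ (by positivity), mul_comm s]
      gcongr)
  have r1 : ∀ w : ℝ, 0 < w → P * s / (a * w) / s = P / (a * w) := fun w hw => by field_simp
  have r2 : ∀ w : ℝ, 0 < w → a * (P * s / (a * w)) / s = P / w := fun w hw => by field_simp
  have r3 : ∀ w : ℝ, 0 < w → c * (P * s / (a * w)) = P / (a * w / (c * s)) :=
    fun w hw => by field_simp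
  have r4 : ∀ w : ℝ, 0 < w → a * (P * s / (a * w)) / c = P / (c * w / s) :=
    fun w hw => by field_simp
  have r5 : ∀ w : ℝ, 0 < w → a * (P * s / (a * w)) = P / (w / s) := fun w hw => by field_simp
  have r6 : ∀ w : ℝ, 0 < w → c * (P * s / (a * w)) / s = P / (a * w / c) :=
    fun w hw => by field_simp
  have r7 : ∀ w : ℝ, 0 < w → a * (P * s / (a * w)) / (c * s) = P / (c * w) :=
    fun w hw => by field_simp
  have r8 : ∀ w : ℝ, 0 < w → P * s / (a * w) = P / (a * w / s) := fun w hw => by field_simp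
  rw [r1 u hu, r1 v hv, r2 u hu, r2 v hv, r4 u hu, r4 v hv, r6 u hu, r6 v hv, r7 u hu, r7 v hv,
    r3 u hu, r3 v hv, r5 u hu, r5 v hv, r8 u hu, r8 v hv] at h
  linarith

/-- The quotient of consecutive elliptic binomial coefficients increases with `u = q ^ (x + 1)`,
stated with the denominators cleared. -/
lemma theta_prod_le {a c s u v p : ℝ} (hp0 : 0 < p) (hp1 : p < 1) (hac : a ≤ c) (hc : c ≤ 1)
    (hs0 : 0 < s) (hs1 : s ≤ 1) (ha : 0 < a) (hu : 0 < u) (huv : u ≤ v) (hvs : v ≤ s)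
    (hpu : p ≤ a * u) :
    theta u p * theta (a * u) p * theta (c * u / s) p * theta (a * u / (c * s)) p *
        (theta (v / s) p * theta (a * v / s) p * theta (c * v) p * theta (a * v / c) p) ≤
      theta v p * theta (a * v) p * theta (c * v / s) p * theta (a * v / (c * s)) p *
        (theta (u / s) p * theta (a * u / s) p * theta (c * u) p * theta (a * u / c) p) := by
  have hc0 : 0 < c := ha.trans_le hac
  have hv : 0 < v := hu.trans_le huv
  have T := tendsto_theta hp0 hp1
  have hlim : ∀ w w' : ℝ, Tendsto (fun n : ℕ => ∏ j ∈ Finset.range n,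
      (((1 - w * p ^ j) * (1 - p / w * p ^ j)) *
        ((1 - a * w * p ^ j) * (1 - p / (a * w) * p ^ j)) *
        ((1 - c * w / s * p ^ j) * (1 - p / (c * w / s) * p ^ j)) *
        ((1 - a * w / (c * s) * p ^ j) * (1 - p / (a * w / (c * s)) * p ^ j)) *
      (((1 - w' / s * p ^ j) * (1 - p / (w' / s) * p ^ j)) *
        ((1 - a * w' / s * p ^ j) * (1 - p / (a * w' / s) * p ^ j)) *
        ((1 - c * w' * p ^ j) * (1 - p / (c * w') * p ^ j)) *
        ((1 - a * w' / c * p ^ j) * (1 - p / (a * w' / c) * p ^ j))))) atTop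
      (𝓝 (theta w p * theta (a * w) p * theta (c * w / s) p * theta (a * w / (c * s)) p *
        (theta (w' / s) p * theta (a * w' / s) p * theta (c * w') p * theta (a * w' / c) p))) := by
    intro w w'
    have := ((((T w).mul (T (a * w))).mul (T (c * w / s))).mul (T (a * w / (c * s)))).mul
      ((((T (w' / s)).mul (T (a * w' / s))).mul (T (c * w'))).mul (T (a * w' / c)))
    simpa only [← Finset.prod_mul_distrib] using this
  refine le_of_tendsto_of_tendsto' (hlim u v) (hlim v u) fun n => ?_
  -- Every factor of every partial product is nonnegative, as all arguments lie in `[p, 1]`.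
  have hnn : ∀ (z : ℝ) (j : ℕ), p ≤ z → z ≤ 1 →
      0 ≤ 1 - z * p ^ j ∧ 0 ≤ 1 - p / z * p ^ j := by
    intro z j hz hz1
    have hj : p ^ j ≤ 1 := pow_le_one₀ hp0.le hp1.le
    have hz0 := hp0.trans_le hz
    exact ⟨sub_nonneg.2 (mul_le_one₀ hz1 (by positivity) hj),
      sub_nonneg.2 (mul_le_one₀ ((div_le_one hz0).2 hz) (by positivity) hj)⟩
  have hav : a * v ≤ c * v := by gcongr
  have hcv : c * v ≤ v := mul_le_of_le_one_left hv.le hc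
  have hau : a * u ≤ c * u := by gcongr
  have hcu : c * u ≤ u := mul_le_of_le_one_left hu.le hc
  have hauv : a * u ≤ a * v := by gcongr
  have hdiv : ∀ w t : ℝ, 0 < t → t ≤ 1 → 0 ≤ w → w ≤ w / t := fun w t ht ht1 hw =>
    le_div_self hw ht ht1
  -- The left-hand factors of `one_sub_prod_le` and `one_sub_inv_prod_le`, respectively.
  have hnonneg : ∀ j : ℕ,
      0 ≤ (1 - u * p ^ j) * (1 - a * u * p ^ j) * (1 - c * u / s * p ^ j) *
            (1 - a * u / (c * s) * p ^ j) *
          ((1 - v / s * p ^ j) * (1 - a * v / s * p ^ j) * (1 - c * v * p ^ j) *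
            (1 - a * v / c * p ^ j)) ∧
        0 ≤ (1 - p / u * p ^ j) * (1 - p / (a * u) * p ^ j) * (1 - p / (c * u / s) * p ^ j) *
            (1 - p / (a * u / (c * s)) * p ^ j) *
          ((1 - p / (v / s) * p ^ j) * (1 - p / (a * v / s) * p ^ j) *
            (1 - p / (c * v) * p ^ j) * (1 - p / (a * v / c) * p ^ j)) := by
    intro j
    obtain ⟨h1, h1'⟩ := hnn u j (by linarith) (by linarith)
    obtain ⟨h2, h2'⟩ := hnn (a * u) j (by linarith) (by linarith)
    obtain ⟨h3, h3'⟩ := hnn (c * u / s) j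
      ((by linarith : p ≤ c * u).trans (hdiv _ s hs0 hs1 (by positivity)))
      ((div_le_one hs0).2 (by linarith))
    obtain ⟨h4, h4'⟩ := hnn (a * u / (c * s)) j
      (hpu.trans (hdiv _ (c * s) (by positivity) (mul_le_one₀ hc hs0.le hs1) (by positivity)))
      ((div_le_one (by positivity)).2 (mul_le_mul hac (huv.trans hvs) hu.le hc0.le))
    obtain ⟨h5, h5'⟩ := hnn (v / s) j
      ((by linarith : p ≤ v).trans (hdiv _ s hs0 hs1 hv.le)) ((div_le_one hs0).2 hvs)
    obtain ⟨h6, h6'⟩ := hnn (a * v / s) j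
      ((by linarith : p ≤ a * v).trans (hdiv _ s hs0 hs1 (by positivity)))
      ((div_le_one hs0).2 (by linarith))
    obtain ⟨h7, h7'⟩ := hnn (c * v) j (by linarith) (by linarith)
    obtain ⟨h8, h8'⟩ := hnn (a * v / c) j
      ((by linarith : p ≤ a * v).trans (hdiv _ c hc0 hc (by positivity)))
      ((div_le_one hc0).2 ((mul_le_of_le_one_right ha.le (hvs.trans hs1)).trans hac))
    constructor <;> positivity
  have reorder : ∀ x₁ x₂ x₃ x₄ x₅ x₆ x₇ x₈ y₁ y₂ y₃ y₄ y₅ y₆ y₇ y₈ : ℝ,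
      x₁ * y₁ * (x₂ * y₂) * (x₃ * y₃) * (x₄ * y₄) *
          (x₅ * y₅ * (x₆ * y₆) * (x₇ * y₇) * (x₈ * y₈)) =
        x₁ * x₂ * x₃ * x₄ * (x₅ * x₆ * x₇ * x₈) * (y₁ * y₂ * y₃ * y₄ * (y₅ * y₆ * y₇ * y₈)) := by
    intros
    ring
  simp only [reorder]
  refine Finset.prod_le_prod (fun j _ => mul_nonneg (hnonneg j).1 (hnonneg j).2) fun j _ => ?_
  have hj1 : p ^ j ≤ 1 := pow_le_one₀ hp0.le hp1.le
  have A := one_sub_prod_le (u := u * p ^ j) (v := v * p ^ j) ha hac hc hs0 hs1 (by positivity)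
    (by gcongr) ((mul_le_of_le_one_right hv.le hj1).trans hvs)
  have B := one_sub_inv_prod_le (P := p * p ^ j) ha hac hc hs0 hs1 hu huv (by positivity)
    ((mul_le_of_le_one_right hp0.le hj1).trans hpu)
  obtain ⟨hA, hB⟩ := hnonneg j
  have hfac : ∀ w t : ℝ, w * p ^ j / t = w / t * p ^ j := fun w t => mul_div_right_comm _ _ _
  simp only [← mul_assoc a, ← mul_assoc c u, ← mul_assoc c v, hfac] at A B
  exact mul_le_mul A B hB (hA.trans A)

/-! ### Elliptic binomial coefficients -/

/-- The elliptic binomial coefficient in the multiplicative variable `q ^ (x + 1)`. -/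
lemma ellBinom_eq {a b q p x : ℝ} {k : ℕ} (hq0 : 0 < q) :
    ellBinom a b q p x k =
      (thetaFact (q ^ (x + 1) / q ^ k) q p k * thetaFact (a * q ^ (x + 1) / q ^ k) q p k *
          thetaFact (b * q ^ k * q) q p k * thetaFact (a * q / (b * q ^ k)) q p k) /
        (thetaFact q q p k * thetaFact (a * q) q p k *
          thetaFact (b * q ^ k * q ^ (x + 1) / q ^ k) q p k *
          thetaFact (a * q ^ (x + 1) / (b * q ^ k * q ^ k)) q p k) := by
  have hs : (q : ℝ) ^ k ≠ 0 := by positivity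
  have e1 : q ^ (1 + x - (k : ℝ)) = q ^ (x + 1) / q ^ k := by
    rw [Real.rpow_sub hq0, Real.rpow_natCast, add_comm]
  have e2 : q ^ (1 + (k : ℝ)) = q ^ k * q := by
    rw [Real.rpow_add hq0, Real.rpow_natCast, Real.rpow_one, mul_comm]
  have e3 : q ^ (1 - (k : ℝ)) = q / q ^ k := by
    rw [Real.rpow_sub hq0, Real.rpow_natCast, Real.rpow_one]
  have e4 : q ^ (1 + x - 2 * (k : ℝ)) = q ^ (x + 1) / (q ^ k * q ^ k) := by
    rw [Real.rpow_sub hq0, two_mul, Real.rpow_add hq0 (k : ℝ), Real.rpow_natCast, add_comm]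
  have e5 : b * q ^ (1 + x) = b * q ^ k * q ^ (x + 1) / q ^ k := by
    rw [mul_right_comm, mul_div_cancel_right₀ _ hs, add_comm]
  have e6 : a * (q / q ^ k) / b = a * q / (b * q ^ k) := by
    rw [mul_div_assoc', div_div, mul_comm b]
  have e7 : a * (q ^ (x + 1) / (q ^ k * q ^ k)) / b = a * q ^ (x + 1) / (b * q ^ k * q ^ k) := by
    rw [mul_div_assoc', div_div, mul_comm _ b, mul_assoc b]
  have e8 : a * (q ^ (x + 1) / q ^ k) = a * q ^ (x + 1) / q ^ k := (mul_div_assoc _ _ _).symm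
  have e9 : b * (q ^ k * q) = b * q ^ k * q := (mul_assoc _ _ _).symm
  rw [ellBinom, e1, e2, e3, e4, e5, e6, e7, e8, e9]

/-- The quotient of consecutive coefficients, from telescoping each of the four theta shifted
factorials that depend on `x`. -/
lemma ellBinom_add_one {a b q p x : ℝ} {k : ℕ} (hq0 : 0 < q)
    (h1 : theta (q ^ (x + 1) / q ^ k) p ≠ 0) (h2 : theta (a * q ^ (x + 1) / q ^ k) p ≠ 0)
    (h3 : theta (b * q ^ k * q ^ (x + 1) / q ^ k) p ≠ 0)
    (h4 : theta (a * q ^ (x + 1) / (b * q ^ k * q ^ k)) p ≠ 0) :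
    ellBinom a b q p (x + 1) k = ellBinom a b q p x k *
      ((theta (q ^ (x + 1)) p * theta (a * q ^ (x + 1)) p *
          theta (b * q ^ k * q ^ (x + 1) / q ^ k) p *
          theta (a * q ^ (x + 1) / (b * q ^ k * q ^ k)) p) /
        (theta (q ^ (x + 1) / q ^ k) p * theta (a * q ^ (x + 1) / q ^ k) p *
          theta (b * q ^ k * q ^ (x + 1)) p * theta (a * q ^ (x + 1) / (b * q ^ k)) p)) := by
  have hs : (q : ℝ) ^ k ≠ 0 := by positivity
  rw [ellBinom_eq hq0, ellBinom_eq hq0, Real.rpow_add_one hq0.ne' (x + 1)]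
  generalize q ^ (x + 1) = u at *
  generalize b * q ^ k = c at *
  have shift : ∀ z : ℝ, theta z p ≠ 0 →
      thetaFact (z * q) q p k = thetaFact z q p k * theta (z * q ^ k) p / theta z p :=
    fun z hz => by rw [eq_div_iff hz, thetaFact_mul_theta]
  have s1 := shift _ h1
  have s2 := shift _ h2
  have s3 := shift _ h3
  have s4 := shift _ h4
  rw [div_mul_cancel₀ _ hs, div_mul_eq_mul_div] at s1 s2 s3
  rw [div_mul_eq_mul_div, div_mul_eq_mul_div, mul_div_mul_right _ _ hs] at s4
  rw [← mul_assoc a, ← mul_assoc c, s1, s2, s3, s4]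
  simp only [div_eq_mul_inv, mul_inv, inv_inv]
  ring

lemma ellBinom_nonneg {a b q p x : ℝ} {k : ℕ} (hq0 : 0 < q) (hq1 : q < 1) (hp0 : 0 < p)
    (ha : 0 < a) (hab : a ≤ b * q ^ k) (hb1 : b * q ^ k < 1) (hus : q ^ (x + 1) < q ^ k)
    (hpu : p < a * q ^ (x + 1)) : 0 ≤ ellBinom a b q p x k := by
  rw [ellBinom_eq hq0]
  have hu : 0 < q ^ (x + 1) := Real.rpow_pos_of_pos hq0 _
  have hs0 : 0 < q ^ k := by positivity
  have hs1 : q ^ k ≤ 1 := pow_le_one₀ hq0.le hq1.le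
  have P : ∀ {z : ℝ}, 0 < z → z < 1 → p * q < z * q ^ k → 0 < thetaFact z q p k :=
    fun h0 h1 h => thetaFact_pos hp0 hq0 hq1 h0 h1 h
  generalize q ^ (x + 1) = u at *
  generalize b * q ^ k = c at *
  generalize q ^ k = s at *
  have hc0 : 0 < c := ha.trans_le hab
  have hau : a * u ≤ c * u := by gcongr
  have hcu : c * u < u := mul_lt_of_lt_one_left hu hb1
  have has : a * u < a * s := by gcongr
  have hacs : a * s ≤ c * s := by gcongr
  have hcs : c * s < s := mul_lt_of_lt_one_left hs0 hb1
  have hpq : p * q < p := mul_lt_of_lt_one_right hp0 hq1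
  have hmul : ∀ w : ℝ, p < w → p * q < w * q := fun w hw => by gcongr
  have hac : a / c ≤ 1 := (div_le_one hc0).2 hab
  have haq : a * q < 1 := by nlinarith
  have hdc : ∀ w : ℝ, 0 ≤ w → w ≤ w / c := fun w hw => le_div_self hw hc0 hb1.le
  have t1 := P (z := u / s) (by positivity) ((div_lt_one hs0).2 hus) (by
    rw [div_mul_cancel₀ _ hs0.ne']
    linarith)
  have t2 := P (z := a * u / s) (by positivity) ((div_lt_one hs0).2 (by linarith)) (by
    rw [div_mul_cancel₀ _ hs0.ne']
    linarith)
  have t3 := P (z := c * q) (by positivity) (by nlinarith) (by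
    rw [mul_right_comm]
    exact hmul _ (by linarith))
  have t4 := P (z := a * q / c) (by positivity) ((div_lt_one hc0).2 (by nlinarith)) (by
    rw [div_mul_eq_mul_div, mul_right_comm, ← div_mul_eq_mul_div]
    exact hmul _ (by linarith [hdc (a * s) (by positivity)]))
  have t5 := P (z := q) hq0 hq1 (by
    rw [mul_comm q]
    exact hmul _ (by linarith))
  have t6 := P (z := a * q) (by positivity) haq (by
    rw [mul_right_comm]
    exact hmul _ (by linarith))
  have t7 := P (z := c * u / s) (by positivity) ((div_lt_one hs0).2 (by linarith)) (by
    rw [div_mul_cancel₀ _ hs0.ne']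
    linarith)
  have t8 := P (z := a * u / (c * s)) (by positivity)
    ((div_lt_one (by positivity)).2 (by linarith)) (by
      rw [div_mul_eq_mul_div, mul_div_mul_right _ _ hs0.ne']
      linarith [hdc (a * u) (by positivity)])
  positivity

/-- The first shifted factorial in the numerator contains the factor `θ 1 = 0`. -/
lemma ellBinom_natCast_eq_zero {a b q p : ℝ} {k m : ℕ} (hq0 : 0 < q) (hm : m < k) :
    ellBinom a b q p m k = 0 := by
  have h : thetaFact (q ^ ((m : ℝ) + 1) / q ^ k) q p k = 0 := by
    refine thetaFact_eq_zero p (i := k - 1 - m) (by omega) ?_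
    have hk : k = (m + 1) + (k - 1 - m) := by omega
    have hpow : q ^ ((m : ℝ) + 1) = q ^ (m + 1) := by exact_mod_cast Real.rpow_natCast q (m + 1)
    rw [hpow, div_mul_eq_mul_div, ← pow_add, ← hk, div_self (by positivity)]
  rw [ellBinom_eq hq0, h]
  simp

end EllBinom

theorem mainTheorem5 (q p a b x y : ℝ) (k : ℕ)
    (hq0 : 0 < q) (hq1 : q < 1) (hp0 : 0 < p) (hpq : p < q ^ 2)
    (hpa : p * q ^ (-x - 1) < a) (hab : a ≤ b * q ^ k) (hb1 : b * q ^ k < 1)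
    (hxy : y ≤ x) (hy1 : 1 ≤ y) (hdiff : ∃ n : ℕ, x - y = (n : ℝ))
    (hky : (k : ℝ) ≤ y ∨ ∃ m : ℤ, y = (m : ℝ)) :
    EllBinom.ellBinom a b q p (x + 1) k * EllBinom.ellBinom a b q p (y - 1) k ≤
      EllBinom.ellBinom a b q p x k * EllBinom.ellBinom a b q p y k := by
  open EllBinom in
  have hu : 0 < q ^ (x + 1) := Real.rpow_pos_of_pos hq0 _
  have ha : 0 < a := (mul_pos hp0 (Real.rpow_pos_of_pos hq0 _)).trans hpa
  have hpu : p < a * q ^ (x + 1) := by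
    rwa [show -x - 1 = -(x + 1) by ring, Real.rpow_neg hq0.le, mul_inv_lt_iff₀ hu] at hpa
  have hanti : ∀ {r t : ℝ}, r ≤ t → q ^ t ≤ q ^ r := fun h =>
    Real.rpow_le_rpow_of_exponent_ge hq0 hq1.le h
  have hlt : ∀ {t : ℝ}, (k : ℝ) < t → q ^ t < q ^ k := fun h => by
    rw [← Real.rpow_natCast]
    exact Real.rpow_lt_rpow_of_exponent_gt hq0 hq1 h
  have hnonneg : ∀ z : ℝ, (k : ℝ) < z + 1 → z ≤ x → 0 ≤ ellBinom a b q p z k := fun z h h' =>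
    ellBinom_nonneg hq0 hq1 hp0 ha hab hb1 (hlt h)
      (hpu.trans_le (mul_le_mul_of_nonneg_left (hanti (by linarith)) ha.le))
  rcases lt_or_ge (k : ℝ) y with hlarge | hsmall
  · have hv : 0 < q ^ y := Real.rpow_pos_of_pos hq0 _
    have hs0 : 0 < q ^ k := by positivity
    have hs1 : q ^ k ≤ 1 := pow_le_one₀ hq0.le hq1.le
    have huv : q ^ (x + 1) ≤ q ^ y := hanti (by linarith)
    have hvs : q ^ y < q ^ k := hlt hlarge
    have hx0 := hnonneg x (by linarith) le_rfl
    have hy0 := hnonneg (y - 1) (by linarith) (by linarith)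
    have hc0 : 0 < b * q ^ k := ha.trans_le hab
    have hp1 : p < 1 := hpq.trans (pow_lt_one₀ hq0.le hq1 two_ne_zero)
    have hpos : ∀ w : ℝ, 0 < w → w < q ^ k → p < a * w →
        0 < theta (w / q ^ k) p ∧ 0 < theta (a * w / q ^ k) p ∧
          0 < theta (b * q ^ k * w / q ^ k) p ∧ 0 < theta (a * w / (b * q ^ k * q ^ k)) p ∧
          0 < theta (b * q ^ k * w) p ∧ 0 < theta (a * w / (b * q ^ k)) p := by
      intro w hw hws hpw
      generalize b * q ^ k = c at *
      generalize q ^ k = s at *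
      have haw : a * w ≤ c * w := by gcongr
      have hcw : c * w < w := mul_lt_of_lt_one_left hw hb1
      have hacs : a * w < c * s := by nlinarith
      have hds : ∀ r : ℝ, 0 ≤ r → r ≤ r / s := fun r hr => le_div_self hr hs0 hs1
      have hdc : ∀ r : ℝ, 0 ≤ r → r ≤ r / c := fun r hr => le_div_self hr hc0 hb1.le
      have hcs1 : c * s ≤ 1 := mul_le_one₀ hb1.le hs0.le hs1
      refine ⟨theta_pos hp0 ?_ ?_, theta_pos hp0 ?_ ?_, theta_pos hp0 ?_ ?_, theta_pos hp0 ?_ ?_,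
        theta_pos hp0 ?_ ?_, theta_pos hp0 ?_ ?_⟩
      · linarith [hds w hw.le]
      · exact (div_lt_one hs0).2 hws
      · linarith [hds (a * w) (by positivity)]
      · exact (div_lt_one hs0).2 (by linarith)
      · linarith [hds (c * w) (by positivity)]
      · exact (div_lt_one hs0).2 (by linarith)
      · exact hpw.trans_le (le_div_self (by positivity) (by positivity) hcs1)
      · exact (div_lt_one (by positivity)).2 hacs
      · linarith
      · linarith
      · linarith [hdc (a * w) (by positivity)]
      · exact (div_lt_one hc0).2 (by nlinarith)
    obtain ⟨u1, u2, u3, u4, u5, u6⟩ := hpos _ hu (huv.trans_lt hvs) hpu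
    obtain ⟨v1, v2, v3, v4, v5, v6⟩ := hpos _ hv hvs
      (hpu.trans_le (mul_le_mul_of_nonneg_left huv ha.le))
    have ex := ellBinom_add_one (x := x) hq0 u1.ne' u2.ne' u3.ne' u4.ne'
    have ey := ellBinom_add_one (a := a) (b := b) (p := p) (k := k) (x := y - 1) hq0
      (by rw [sub_add_cancel]; exact v1.ne') (by rw [sub_add_cancel]; exact v2.ne')
      (by rw [sub_add_cancel]; exact v3.ne') (by rw [sub_add_cancel]; exact v4.ne')
    rw [sub_add_cancel] at ey
    rw [ex, ey, mul_right_comm, ← mul_assoc]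
    refine mul_le_mul_of_nonneg_left ?_ (mul_nonneg hx0 hy0)
    rw [div_le_div_iff₀ (by positivity) (by positivity)]
    exact theta_prod_le hp0 hp1 hab hb1.le hs0 hs1 ha hu huv hvs.le hpu.le
  -- Here `y = n + 1` for a natural number `n < k`, so that `[y - 1] = 0`.
  · have hint : ∃ m : ℤ, y = (m : ℝ) := by
      rcases hky with h | h
      · exact ⟨k, by push_cast; linarith⟩
      · exact h
    obtain ⟨m, rfl⟩ := hint
    have hm1 : 1 ≤ m := by exact_mod_cast hy1
    have hmk : m ≤ k := by exact_mod_cast hsmall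
    obtain ⟨n, rfl⟩ : ∃ n : ℕ, m = n + 1 := ⟨(m - 1).toNat, by omega⟩
    have hn : (((n : ℤ) + 1 : ℤ) : ℝ) = ((n + 1 : ℕ) : ℝ) := by push_cast; ring
    rw [hn] at hsmall hxy ⊢
    have hzero : ellBinom a b q p (((n + 1 : ℕ) : ℝ) - 1) k = 0 := by
      rw [Nat.cast_succ, add_sub_cancel_right]
      exact ellBinom_natCast_eq_zero hq0 (by omega)
    rw [hzero, mul_zero]
    rcases lt_or_eq_of_le (by exact_mod_cast hsmall : n + 1 ≤ k) with h | h
    · rw [ellBinom_natCast_eq_zero hq0 h, mul_zero]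
    · rw [h] at hxy ⊢
      exact mul_nonneg (hnonneg x (by linarith) le_rfl) (hnonneg _ (by linarith) hxy)
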